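/- Let $F$ be a field of characteristic zero and let $E$ be the infinite dimensional (unital) Grassmann algebra over $F$ of a vector space $L$ with basis $e_1,e_2,\ldots$. Let $m<n$ be integers and split the set of generators $e_i$ into two infinite sets; give the generators in the first set degree $m$ and those in the second set degree $n$. Denote by $E_{(m,n)}^{(\infty,\infty)}$ the algebra $E$ with the induced $\mathbb{Z}$-grading, in which $\|e_{k_1}\cdots e_{k_s}\|=\|e_{k_1}\|+\cdots+\|e_{k_s}\|$. Suppose that this grading has full support, that is, every homogeneous component is nonzero, and that there are $\alpha,\beta,\alpha',\beta'\in\{0,1,2,\ldots\}$ with $$1=\alpha m+\beta n,\qquad -1=\alpha' m+\beta' n,$$ such that $\alpha+\beta$ and $\alpha'+\beta'$ are both even (the sums are not required to be minimal among all such representations; if both minimal sums happen to be even, the hypothesis holds). Then $E_{(m,n)}^{(\infty,\infty)}$ generates the variety $\mathfrak{V}_1^{\mathbb{Z}}$ of $\mathbb{Z}$-graded algebras defined by the polynomials $[x_1,x_2,x_3]=[[x_1,x_2],x_3]$ for all degrees of $x_1,x_2,x_3$. That is, the ideal $T_{\mathbb{Z}}(E_{(m,n)}^{(\infty,\infty)})$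 of all $\mathbb{Z}$-graded polynomial identities of $E_{(m,n)}^{(\infty,\infty)}$ in the free $\mathbb{Z}$-graded algebra $F\langle X|\mathbb{Z}\rangle$ (countably many variables in each degree) is equal to the $T_{\mathbb{Z}}$-ideal generated by these polynomials, i.e. the smallest two-sided ideal that contains them and is invariant under all $\mathbb{Z}$-graded endomorphisms of $F\langle X|\mathbb{Z}\rangle$. -/

import Mathlib

open scoped DirectSum

noncomputable section

namespace GradedPI

section Grassmann

variable (F : Type*) [Field F]

/-- The infinite dimensional Grassmann algebra `E` of the vector space `L` with basis indexed
by `ℕ`. -/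
abbrev Grassmann : Type _ := ExteriorAlgebra F (ℕ →₀ F)

/-- The generator `e_i` of the Grassmann algebra. -/
def gen (i : ℕ) : Grassmann F := ExteriorAlgebra.ι F (Finsupp.single i 1)

/-- The monomial `e_{k_1} ⋯ e_{k_s}` (it is zero when a generator is repeated). -/
def monomial (l : List ℕ) : Grassmann F := (l.map (gen F)).prod

/-- The homogeneous component of degree `r` of the `ℤ`-grading on `E` in which the generator
`e_i` has degree `deg i`: the span of all monomials `e_{k_1} ⋯ e_{k_s}` with
`deg k_1 + ⋯ + deg k_s = r`. -/
def inducedGrading (deg : ℕ → ℤ) (r : ℤ) : Submodule F (Grassmann F) :=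
  Submodule.span F {w | ∃ l : List ℕ, (l.map deg).sum = r ∧ w = monomial F l}

variable {F}

lemma gen_mem (deg : ℕ → ℤ) (i : ℕ) : gen F i ∈ inducedGrading F deg (deg i) :=
  Submodule.subset_span ⟨[i], by simp, by simp [monomial]⟩

lemma gen_mul_gen_add_swap (i j : ℕ) : gen F i * gen F j + gen F j * gen F i = 0 :=
  ExteriorAlgebra.ι_add_mul_swap _ _

instance inducedGrading.gradedMonoid (deg : ℕ → ℤ) :
    SetLike.GradedMonoid (inducedGrading F deg) where
  one_mem := Submodule.subset_span ⟨[], by simp, by simp [monomial]⟩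
  mul_mem := by
    intro i j x y hx hy
    have h : inducedGrading F deg i * inducedGrading F deg j ≤ inducedGrading F deg (i + j) := by
      unfold inducedGrading
      rw [Submodule.span_mul_span]
      apply Submodule.span_mono
      rintro _ ⟨_, ⟨l, hl, rfl⟩, _, ⟨l', hl', rfl⟩, rfl⟩
      exact ⟨l ++ l', by simp [hl, hl'], by simp [monomial]⟩
    exact h (Submodule.mul_mem_mul hx hy)

/-- The generator `e_i` inside the direct sum of the homogeneous components. -/
def gradedGen (deg : ℕ → ℤ) (i : ℕ) : ⨁ r, inducedGrading F deg r :=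
  DirectSum.of (fun r => inducedGrading F deg r) (deg i) ⟨gen F i, gen_mem deg i⟩

lemma of_mul_of_eq (deg : ℕ → ℤ) {i j k : ℤ} (h : i + j = k) {x y : Grassmann F}
    (hx : x ∈ inducedGrading F deg i) (hy : y ∈ inducedGrading F deg j)
    (hxy : x * y ∈ inducedGrading F deg k) :
    DirectSum.of (fun r => inducedGrading F deg r) i ⟨x, hx⟩ *
      DirectSum.of (fun r => inducedGrading F deg r) j ⟨y, hy⟩ =
      DirectSum.of (fun r => inducedGrading F deg r) k ⟨x * y, hxy⟩ := by
  subst h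
  exact DirectSum.of_mul_of _ _

lemma gradedGen_add_swap (deg : ℕ → ℤ) (i j : ℕ) :
    gradedGen (F := F) deg i * gradedGen deg j + gradedGen deg j * gradedGen deg i = 0 := by
  have hm : gen F i * gen F j ∈ inducedGrading F deg (deg i + deg j) :=
    SetLike.mul_mem_graded (gen_mem deg i) (gen_mem deg j)
  have hm' : gen F j * gen F i ∈ inducedGrading F deg (deg i + deg j) := by
    rw [add_comm]
    exact SetLike.mul_mem_graded (gen_mem deg j) (gen_mem deg i)
  unfold gradedGen
  rw [of_mul_of_eq deg rfl _ _ hm, of_mul_of_eq deg (add_comm _ _) _ _ hm', ← map_add]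
  have h0 : (⟨gen F i * gen F j, hm⟩ : inducedGrading F deg (deg i + deg j)) +
      ⟨gen F j * gen F i, hm'⟩ = 0 := Subtype.ext (gen_mul_gen_add_swap i j)
  rw [h0, map_zero]

lemma gradedGen_sq (deg : ℕ → ℤ) (i : ℕ) :
    gradedGen (F := F) deg i * gradedGen deg i = 0 := by
  have hm : gen F i * gen F i ∈ inducedGrading F deg (deg i + deg i) :=
    SetLike.mul_mem_graded (gen_mem deg i) (gen_mem deg i)
  unfold gradedGen
  rw [of_mul_of_eq deg rfl _ _ hm]
  have h0 : (⟨gen F i * gen F i, hm⟩ : inducedGrading F deg (deg i + deg i)) = 0 :=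
    Subtype.ext (ExteriorAlgebra.ι_sq_zero _)
  rw [h0, map_zero]

/-- The inclusion of `L` into the direct sum of the homogeneous components. -/
def gradedι (deg : ℕ → ℤ) : (ℕ →₀ F) →ₗ[F] ⨁ r, inducedGrading F deg r :=
  Finsupp.linearCombination F (gradedGen deg)

lemma gradedι_add_swap (deg : ℕ → ℤ) (x y : ℕ →₀ F) :
    gradedι deg x * gradedι deg y + gradedι deg y * gradedι deg x = 0 := by
  induction x using Finsupp.induction_linear with
  | zero => simp
  | add a b ha hb =>
    rw [map_add, add_mul, mul_add, add_add_add_comm, ha, hb, add_zero]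
  | single i a =>
    induction y using Finsupp.induction_linear with
    | zero => simp
    | add b c hb hc =>
      rw [map_add, add_mul, mul_add, add_add_add_comm, hb, hc, add_zero]
    | single j b =>
      simp only [gradedι, Finsupp.linearCombination_single, smul_mul_smul_comm]
      rw [mul_comm b a, ← smul_add, gradedGen_add_swap, smul_zero]

lemma gradedι_sq (deg : ℕ → ℤ) (x : ℕ →₀ F) : gradedι deg x * gradedι deg x = 0 := by
  induction x using Finsupp.induction_linear with
  | zero => simp
  | add a b ha hb =>
    rw [map_add, add_mul, mul_add, mul_add, ha, hb, zero_add, add_zero, gradedι_add_swap]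
  | single i a =>
    simp only [gradedι, Finsupp.linearCombination_single, smul_mul_smul_comm, gradedGen_sq,
      smul_zero]

/-- The decomposition of an element of `E` into its homogeneous components. -/
def gradedLift (deg : ℕ → ℤ) : Grassmann F →ₐ[F] ⨁ r, inducedGrading F deg r :=
  ExteriorAlgebra.lift F ⟨gradedι deg, gradedι_sq deg⟩

lemma gradedLift_gen (deg : ℕ → ℤ) (i : ℕ) :
    gradedLift deg (gen F i) = gradedGen deg i := by
  simp [gradedLift, gen, gradedι]

lemma gradedLift_monomial (deg : ℕ → ℤ) (l : List ℕ) (r : ℤ) (hr : (l.map deg).sum = r)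
    (hm : monomial F l ∈ inducedGrading F deg r) :
    gradedLift deg (monomial F l) =
      DirectSum.of (fun r => inducedGrading F deg r) r ⟨monomial F l, hm⟩ := by
  induction l generalizing r with
  | nil =>
    subst hr
    simp only [monomial, List.map_nil, List.prod_nil, map_one, DirectSum.one_def]
    rfl
  | cons i l ih =>
    have h1 : monomial F l ∈ inducedGrading F deg (l.map deg).sum :=
      Submodule.subset_span ⟨l, rfl, rfl⟩
    have h2 : monomial F (i :: l) = gen F i * monomial F l := by simp [monomial]
    have h3 : gen F i * monomial F l ∈ inducedGrading F deg r := h2 ▸ hm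
    simp only [h2]
    rw [map_mul, gradedLift_gen, ih _ rfl h1, gradedGen]
    exact of_mul_of_eq deg (by simpa using hr) _ _ h3

/-- The induced components do form a `ℤ`-grading of the algebra `E`. -/
instance inducedGrading.gradedAlgebra (deg : ℕ → ℤ) : GradedAlgebra (inducedGrading F deg) :=
  GradedAlgebra.ofAlgHom _ (gradedLift deg)
    (by
      ext i
      simp [gradedLift, gradedι, gradedGen, gen])
    (by
      rintro r ⟨x, hx⟩
      dsimp only
      induction hx using Submodule.span_induction with
      | mem x h =>
        obtain ⟨l, hl, rfl⟩ := h
        exact gradedLift_monomial deg l r hl _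
      | zero =>
        rw [map_zero]
        exact (map_zero (DirectSum.of (fun r => inducedGrading F deg r) r)).symm
      | add x y hx hy ihx ihy =>
        rw [map_add, ihx, ihy, ← map_add]
        rfl
      | smul a x hx ih =>
        rw [map_smul, ih, ← DirectSum.lof_eq_of F, ← map_smul, DirectSum.lof_eq_of]
        rfl)

open scoped Classical in
/-- The degree of the generator `e_i` for the splitting of the generators into the set of those
with `i ∈ S`, which get degree `m`, and the set of the others, which get degree `n`. -/
def twoDegree (m n : ℤ) (S : Set ℕ) (i : ℕ) : ℤ := if i ∈ S then m else n

variable (F)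

/-- The `2`-induced grading `E_{(m, n)}^{(u, v)}` for the decomposition `L = L_m^u ⊕ L_n^v`, where
`L_m^u` is spanned by the `e_i` with `i ∈ S`, and `L_n^v` by the other `e_i`. The
upper indexes `u` and `v` are the numbers of elements of `S` and of its complement. -/
abbrev twoInduced (m n : ℤ) (S : Set ℕ) : ℤ → Submodule F (Grassmann F) :=
  inducedGrading F (twoDegree m n S)

end Grassmann

section Identities

variable {F : Type*} [Field F]

/-- The support of a `ℤ`-grading: the set of degrees whose component is nonzero. -/
def gradingSupport {A : Type*} [Ring A] [Algebra F A] (𝒜 : ℤ → Submodule F A) : Set ℤ :=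
  {r | 𝒜 r ≠ ⊥}

variable (F) in
/-- The free algebra `F⟨X|ℤ⟩`; the pair `(i, k)` stands for the variable `x_k^i`, of degree `i`. -/
abbrev FreeGraded : Type _ := FreeAlgebra F (ℤ × ℕ)

variable (F) in
/-- The variable `x_k^i`. -/
def var (i : ℤ) (k : ℕ) : FreeGraded F := FreeAlgebra.ι F (i, k)

variable (F) in
/-- The component `F⟨X|ℤ⟩^i`: the span of all monomials in the variables of degree `i`. -/
def freeComponent (i : ℤ) : Submodule F (FreeGraded F) :=
  Submodule.span F {w | ∃ l : List (ℤ × ℕ),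
    (l.map Prod.fst).sum = i ∧ w = (l.map (fun p => var F p.1 p.2)).prod}

/-- `T_ℤ(A)`: the ideal of all `ℤ`-graded polynomial identities of the graded algebra `A`, the
polynomials that vanish under every substitution of elements of `A_i` for the variables of
degree `i`, for all `i`. -/
def gradedIdentities {A : Type*} [Ring A] [Algebra F A] (𝒜 : ℤ → Submodule F A)
    [GradedAlgebra 𝒜] : TwoSidedIdeal (FreeGraded F) :=
  TwoSidedIdeal.mk'
    {f | ∀ g : ℤ × ℕ → A, (∀ p, g p ∈ 𝒜 p.1) → FreeAlgebra.lift F g f = 0}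
    (fun _ _ => map_zero _)
    (fun hx hy g hg => by rw [map_add, hx g hg, hy g hg, add_zero])
    (fun hx g hg => by rw [map_neg, hx g hg, neg_zero])
    (fun hy g hg => by rw [map_mul, hy g hg, mul_zero])
    (fun hx g hg => by rw [map_mul, hx g hg, zero_mul])

/-- A `T_ℤ`-ideal: a two-sided ideal of `F⟨X|ℤ⟩` that every `ℤ`-graded endomorphism maps into
itself. -/
def IsTIdeal (I : TwoSidedIdeal (FreeGraded F)) : Prop :=
  ∀ φ : FreeGraded F →ₐ[F] FreeGraded F,
    (∀ i, ∀ f ∈ freeComponent F i, φ f ∈ freeComponent F i) → ∀ f ∈ I, φ f ∈ I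

/-- The `T_ℤ`-ideal generated by a set of graded polynomials. -/
def tIdealSpan (P : Set (FreeGraded F)) : TwoSidedIdeal (FreeGraded F) :=
  sInf {I | IsTIdeal I ∧ ∀ f ∈ P, f ∈ I}

/-- The graded algebra `A` generates the variety of the `ℤ`-graded algebras that satisfy the
identities `P`: the `T_ℤ`-ideal of the variety, which is the one generated by `P`, is `T_ℤ(A)`. -/
def GeneratesVariety {A : Type*} [Ring A] [Algebra F A] (𝒜 : ℤ → Submodule F A)
    [GradedAlgebra 𝒜] (P : Set (FreeGraded F)) : Prop :=
  tIdealSpan P = gradedIdentities 𝒜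

/-- The commutator `[a, b] = ab - ba`. -/
def comm {A : Type*} [Ring A] (a b : A) : A := a * b - b * a

variable (F) in
/-- The polynomials `[x_1, x_2, x_3] = [[x_1, x_2], x_3]` for all degrees of the three variables;
they define the variety `𝔙_1`. -/
def tripleCommutators : Set (FreeGraded F) :=
  {f | ∃ i j k : ℤ, f = comm (comm (var F i 1) (var F j 2)) (var F k 3)}

end Identities

end GradedPI

end

/-!
In an algebra with central commutators, `[a, b][a, c] = 0` and hence `[a, b][c, d]` is alternating,
so modulo the triple commutators every polynomial is a combination of products of variables times
products `[x_{i₁}, x_{i₂}] ⋯ [x_{i₂ₖ₋₁}, x_{i₂ₖ}]` with distinct variables, where the order of the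
variables in each of the two factors is prescribed. To see that no nonzero combination of these
normal forms is an identity of `E`, substitute for each variable a sum of monomials of even length,
which are central, plus a monomial of odd length, all with disjoint sets of generators: the odd
parts survive only in the commutators, the even parts only outside, and the coefficients can be
read off one after the other. Such monomials are available in every degree because the
representations of `1` and `-1` give even lengths, and one more generator of degree `m` gives the
odd ones.
-/

noncomputable section

namespace GradedPI

open Finset

section CentralCommutators

variable {A B ι : Type*} [Ring A] [Ring B]

lemma map_comm {Φ : Type*} [FunLike Φ A B] [RingHomClass Φ A B] (φ : Φ) (a b : A) :
    φ (comm a b) = comm (φ a) (φ b) := by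
  simp only [comm, map_sub, map_mul]

lemma comm_self (a : A) : comm a a = 0 := sub_self _

lemma comm_swap (a b : A) : comm a b = -comm b a := (neg_sub _ _).symm

lemma comm_eq_zero_of_commute {a b : A} (h : Commute a b) : comm a b = 0 := sub_eq_zero.2 h

/-- The identity `[[a, b], c] = 0`, which defines the ungraded variety `𝔙₁`. -/
def CentralComm (A : Type*) [Ring A] : Prop := ∀ a b c : A, comm (comm a b) c = 0

lemma CentralComm.commute (h : CentralComm A) (a b c : A) : Commute (comm a b) c :=
  sub_eq_zero.1 (h a b c)

lemma centralComm_of_span {F : Type*} [CommRing F] [Algebra F A] {s : Set A}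
    (hs : Submodule.span F s = ⊤)
    (h : ∀ a ∈ s, ∀ b ∈ s, ∀ c ∈ s, comm (comm a b) c = 0) : CentralComm A := by
  have hspan (x : A) : x ∈ Submodule.span F s := hs ▸ Submodule.mem_top
  have hcenter : ∀ a ∈ s, ∀ b ∈ s, comm a b ∈ Subalgebra.center F A := fun a ha b hb =>
    Subalgebra.mem_center_iff.2 fun c =>
      (Submodule.span_le (p := (Subalgebra.centralizer F {comm a b}).toSubmodule).2
        (fun c hc => by
          rintro _ rfl
          exact sub_eq_zero.1 (h a ha b hb c hc))
        (hspan c) _ rfl).symm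
  intro a b c
  have hab : comm a b ∈ Subalgebra.center F A :=
    LinearMap.BilinMap.apply_apply_mem_of_mem_span (Subalgebra.center F A).toSubmodule s s
      (LinearMap.mul F A - (LinearMap.mul F A).flip) hcenter a b (hspan a) (hspan b)
  exact sub_eq_zero.2 (Subalgebra.mem_center_iff.1 hab c).symm

lemma CentralComm.comm_mul_comm_self [IsAddTorsionFree A] (h : CentralComm A) (a b c : A) :
    comm a b * comm a c = 0 := by
  -- `[[a², b], c]` vanishes and equals `2[a, b][a, c]`, since `[a², b] = 2a[a, b]`
  have hsq : comm (a * a) b = 2 • (a * comm a b) := by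
    have hab : comm a b * a = a * comm a b := h.commute a b a
    calc comm (a * a) b = a * comm a b + comm a b * a := by simp only [comm]; noncomm_ring
      _ = 2 • (a * comm a b) := by rw [hab, two_nsmul]
  have hcomm : comm (a * comm a b) c = comm a b * comm a c := by
    have hc : comm a b * c = c * comm a b := h.commute a b c
    calc comm (a * comm a b) c = comm a c * comm a b + a * (comm a b * c - c * comm a b) := by
          simp only [comm]; noncomm_ring
      _ = comm a b * comm a c := by rw [hc, sub_self, mul_zero, add_zero, h.commute a c]
  refine two_nsmul_eq_zero.1 ?_
  calc 2 • (comm a b * comm a c) = comm (comm (a * a) b) c := by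
        rw [hsq, ← hcomm]; simp only [comm]; noncomm_ring
    _ = 0 := h _ _ _

lemma CentralComm.comm_mul_comm_swap [IsAddTorsionFree A] (h : CentralComm A) (a b c d : A) :
    comm a b * comm c d = -(comm a c * comm b d) := by
  have hpolar : comm a b * comm c d + comm a c * comm b d =
      comm b a * comm b d + comm c a * comm c d - comm (b + c) a * comm (b + c) d := by
    simp only [comm]; noncomm_ring
  simp only [h.comm_mul_comm_self, add_zero, sub_zero] at hpolar
  exact eq_neg_of_add_eq_zero_left hpolar

/-- The product `[x_{i₁}, x_{i₂}][x_{i₃}, x_{i₄}] ⋯` along a list of even length; it is set to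
zero along a list of odd length. -/
def commProd (x : ι → A) : List ι → A
  | [] => 1
  | [_] => 0
  | a :: b :: l => comm (x a) (x b) * commProd x l

lemma map_commProd {Φ : Type*} [FunLike Φ A B] [RingHomClass Φ A B] (φ : Φ) (x : ι → A) :
    ∀ l : List ι, φ (commProd x l) = commProd (φ ∘ x) l
  | [] => map_one φ
  | [_] => map_zero φ
  | a :: b :: l => by simp only [commProd, map_mul, map_comm, map_commProd φ x l, Function.comp]

lemma commProd_of_odd (x : ι → A) : ∀ l : List ι, Odd l.length → commProd x l = 0
  | [], h => by simp at h
  | [_], _ => rfl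
  | a :: b :: l, h => by
    rw [commProd, commProd_of_odd x l (by simp only [List.length_cons] at h; grind), mul_zero]

section TorsionFree

variable [IsAddTorsionFree A]

lemma CentralComm.commProd_append_swap (h : CentralComm A) (x : ι → A) (a b : ι) (l : List ι) :
    ∀ k : List ι, commProd x (k ++ a :: b :: l) = -commProd x (k ++ b :: a :: l)
  | [] => by simp only [List.nil_append, commProd, comm_swap (x a), neg_mul]
  | [c] => by
    cases l with
    | nil => simp only [List.cons_append, List.nil_append, commProd, mul_zero, neg_zero]
    | cons d l =>
      simp only [List.cons_append, List.nil_append, commProd, ← mul_assoc]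
      rw [h.comm_mul_comm_swap, neg_mul]
  | c :: d :: k => by
    simp only [List.cons_append, commProd]
    rw [h.commProd_append_swap x a b l k, mul_neg]

lemma CentralComm.exists_commProd_perm (h : CentralComm A) (x : ι → A) {l l' : List ι}
    (hl : l.Perm l') (k : List ι) :
    ∃ ε : ℤˣ, commProd x (k ++ l) = ε • commProd x (k ++ l') := by
  induction hl generalizing k with
  | nil => exact ⟨1, (one_smul _ _).symm⟩
  | cons a _ ih => simpa using ih (k ++ [a])
  | swap a b l => exact ⟨-1, by simp [h.commProd_append_swap x b a]⟩
  | trans _ _ ih ih' =>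
    obtain ⟨ε, hε⟩ := ih k
    obtain ⟨ε', hε'⟩ := ih' k
    exact ⟨ε * ε', by rw [hε, hε', smul_smul]⟩

lemma CentralComm.commProd_of_not_nodup (h : CentralComm A) (x : ι → A) {l : List ι}
    (hl : ¬ l.Nodup) : commProd x l = 0 := by
  obtain ⟨a, ha⟩ : ∃ a, List.Sublist [a, a] l := by
    simpa [List.nodup_iff_sublist] using hl
  obtain ⟨k, hk⟩ := ha.exists_perm_append
  obtain ⟨ε, hε⟩ := h.exists_commProd_perm x hk []
  simpa [commProd, comm_self] using hε

end TorsionFree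

end CentralCommutators

section NormalForms

variable {A B ι : Type*} [Ring A] [Ring B]

variable (ι) in
/-- The indices of the normal forms: the variables inside the commutators, which are distinct and
even in number, and the variables outside, with their multiplicities. -/
abbrev NormalIndex : Type _ := {T : Finset ι // Even #T} × Multiset ι

/-- The normal form `x_{j₁} ⋯ x_{jₛ} [x_{i₁}, x_{i₂}] ⋯ [x_{i₂ₖ₋₁}, x_{i₂ₖ}]` with the index `q`.
The order of the factors is the one chosen by `Multiset.toList` and `Finset.toList`. -/
def normalForm (x : ι → A) (q : NormalIndex ι) : A :=
  (q.2.toList.map x).prod * commProd x q.1.1.toList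

lemma map_normalForm {Φ : Type*} [FunLike Φ A B] [RingHomClass Φ A B] (φ : Φ) (x : ι → A)
    (q : NormalIndex ι) : φ (normalForm x q) = normalForm (φ ∘ x) q := by
  rw [normalForm, map_mul, map_list_prod, List.map_map, map_commProd, normalForm]

lemma CentralComm.prod_map_swap_mul_commProd (h : CentralComm A) (x : ι → A) (a b : ι)
    (j l k : List ι) :
    ((j ++ a :: b :: l).map x).prod * commProd x k =
      ((j ++ b :: a :: l).map x).prod * commProd x k +
        ((j ++ l).map x).prod * commProd x (a :: b :: k) := by
  have hc : comm (x a) (x b) * (l.map x).prod = (l.map x).prod * comm (x a) (x b) :=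
    h.commute _ _ _
  simp only [List.map_append, List.map_cons, List.prod_append, List.prod_cons, commProd,
    mul_assoc]
  rw [← mul_assoc (l.map x).prod, ← hc]
  simp only [comm]
  noncomm_ring

lemma CentralComm.prod_map_sub_mem_of_perm (h : CentralComm A) (x : ι → A) {N : AddSubgroup A}
    {n : ℕ} (hN : ∀ l : List ι, l.length < n → ∀ k, (l.map x).prod * commProd x k ∈ N)
    {l l' : List ι} (hl : l.Perm l') (j k : List ι) (hj : (j ++ l).length ≤ n) :
    ((j ++ l).map x).prod * commProd x k - ((j ++ l').map x).prod * commProd x k ∈ N := by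
  induction hl generalizing j with
  | nil => simp
  | cons a _ ih => simpa using ih (j ++ [a]) (by simpa [add_assoc] using hj)
  | swap a b l =>
    rw [h.prod_map_swap_mul_commProd, add_sub_cancel_left]
    exact hN (j ++ l) (by simp only [List.length_append, List.length_cons] at hj ⊢; omega) _
  | trans hl₁ _ ih₁ ih₂ =>
    simpa using N.add_mem (ih₁ j hj) (ih₂ j (by simpa [hl₁.length_eq] using hj))

variable {F : Type*} [CommRing F] [Algebra F A] [IsAddTorsionFree A]

lemma CentralComm.toList_prod_mul_commProd_mem (h : CentralComm A) (x : ι → A) (s : Multiset ι)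
    (k : List ι) :
    (s.toList.map x).prod * commProd x k ∈ Submodule.span F (Set.range (normalForm x)) := by
  classical
  by_cases hk : k.Nodup ∧ Even k.length
  · obtain ⟨ε, hε⟩ := h.exists_commProd_perm x (List.toFinset_toList hk.1).symm []
    have heven : Even #k.toFinset := List.toFinset_card_of_nodup hk.1 ▸ hk.2
    have hmem : normalForm x (⟨k.toFinset, heven⟩, s) ∈
        Submodule.span F (Set.range (normalForm x)) := Submodule.subset_span ⟨_, rfl⟩
    simp only [List.nil_append] at hε
    rw [hε, mul_smul_comm, Units.smul_def]
    exact zsmul_mem hmem _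
  · have hzero : commProd x k = 0 := by
      rcases not_and_or.1 hk with hk | hk
      · exact h.commProd_of_not_nodup x hk
      · exact commProd_of_odd x k (Nat.not_even_iff_odd.1 hk)
    rw [hzero, mul_zero]
    exact zero_mem _

lemma CentralComm.prod_map_mul_commProd_mem (h : CentralComm A) (x : ι → A) (l k : List ι) :
    (l.map x).prod * commProd x k ∈ Submodule.span F (Set.range (normalForm x)) := by
  induction hn : l.length using Nat.strong_induction_on generalizing l k with
  | _ n ih =>
    have hsub := h.prod_map_sub_mem_of_perm x
      (N := (Submodule.span F (Set.range (normalForm x))).toAddSubgroup)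
      (fun l hl k => ih _ hl l k rfl)
      (Multiset.coe_eq_coe.1 (Multiset.coe_toList (l : Multiset ι))).symm [] k hn.le
    exact (Submodule.sub_mem_iff_left _ (h.toList_prod_mul_commProd_mem x l k)).1 hsub

lemma span_range_prod_eq_top {R S : Type*} [CommSemiring R] [Semiring S] [Algebra R S]
    {x : ι → S} (hx : Algebra.adjoin R (Set.range x) = ⊤) :
    Submodule.span R (Set.range fun l : List ι => (l.map x).prod) = ⊤ := by
  have hrange : (Submonoid.closure (Set.range x) : Set S) =
      Set.range fun l : List ι => (l.map x).prod := by
    rw [← FreeMonoid.mrange_lift, MonoidHom.coe_mrange]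
    exact congrArg Set.range (funext fun l => FreeMonoid.lift_apply x l)
  rw [← hrange, ← Algebra.adjoin_eq_span, hx, Algebra.top_toSubmodule]

theorem CentralComm.span_range_normalForm (h : CentralComm A) {x : ι → A}
    (hx : Algebra.adjoin F (Set.range x) = ⊤) :
    Submodule.span F (Set.range (normalForm x)) = ⊤ := by
  rw [eq_top_iff, ← span_range_prod_eq_top hx, Submodule.span_le]
  rintro _ ⟨l, rfl⟩
  simpa [commProd] using h.prod_map_mul_commProd_mem (F := F) x l []

end NormalForms

section SquareZero

open scoped Nat

variable {C ι κ : Type*} [CommRing C]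

lemma add_pow_succ_of_mul_self_eq_zero (a : C) {b : C} (hb : b * b = 0) (k : ℕ) :
    (a + b) ^ (k + 1) = a ^ (k + 1) + (k + 1) * a ^ k * b := by
  induction k with
  | zero => simp
  | succ k ih =>
    rw [pow_succ, ih]
    push_cast
    linear_combination (k + 1) * a ^ k * hb

lemma sum_pow_card_succ_eq_zero {w : κ → C} (hw : ∀ j, w j * w j = 0) (s : Finset κ) :
    (∑ j ∈ s, w j) ^ (#s + 1) = 0 := by
  induction s using Finset.cons_induction with
  | empty => simp
  | cons i s hi ih =>
    rw [sum_cons, card_cons, add_comm, add_pow_succ_of_mul_self_eq_zero _ (hw i), pow_succ, ih]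
    ring

lemma sum_pow_card_eq_factorial_mul_prod {w : κ → C} (hw : ∀ j, w j * w j = 0)
    (s : Finset κ) : (∑ j ∈ s, w j) ^ #s = (#s)! * ∏ j ∈ s, w j := by
  induction s using Finset.cons_induction with
  | empty => simp
  | cons i s hi ih =>
    rw [sum_cons, prod_cons, card_cons, add_comm, add_pow_succ_of_mul_self_eq_zero _ (hw i),
      sum_pow_card_succ_eq_zero hw, ih, Nat.factorial_succ]
    push_cast
    ring

variable [DecidableEq ι] {w : ι → ℕ → C}

lemma prod_map_sum_range_count_eq_zero (hw : ∀ p j, w p j * w p j = 0) {s t : Multiset ι}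
    (hst : ¬ t ≤ s) : (t.map fun p => ∑ j ∈ range (s.count p), w p j).prod = 0 := by
  obtain ⟨p, hp⟩ : ∃ p, s.count p < t.count p := by simpa [Multiset.le_iff_count] using hst
  rw [prod_multiset_map_count]
  refine prod_eq_zero (Multiset.mem_toFinset.2 (Multiset.count_pos.1 hp.pos)) ?_
  refine pow_eq_zero_of_le hp ?_
  simpa using sum_pow_card_succ_eq_zero (hw p) (range (s.count p))

lemma prod_map_sum_range_count (hw : ∀ p j, w p j * w p j = 0) (s : Multiset ι) :
    (s.map fun p => ∑ j ∈ range (s.count p), w p j).prod =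
      (∏ p ∈ s.toFinset, (s.count p)! : ℕ) *
        ∏ k ∈ s.toFinset.sigma fun p => range (s.count p), w k.1 k.2 := by
  rw [prod_multiset_map_count, prod_sigma, Nat.cast_prod, ← prod_mul_distrib]
  refine prod_congr rfl fun p _ => ?_
  simpa using sum_pow_card_eq_factorial_mul_prod (hw p) (range (s.count p))

end SquareZero

section Evaluation

open scoped Nat

variable {A C ι : Type*} [Ring A] [CommRing C] [Algebra C A]

lemma comm_algebraMap_add (c d : C) (a b : A) :
    comm (algebraMap C A c + a) (algebraMap C A d + b) = comm a b := by
  have hcd : Commute (algebraMap C A c) (algebraMap C A d) := Algebra.commutes c _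
  have hcb : Commute (algebraMap C A c) b := Algebra.commutes c b
  have hda : Commute (algebraMap C A d) a := Algebra.commutes d a
  simp only [comm, add_mul, mul_add, hcd.eq, hcb.eq, hda.eq]
  abel

lemma commProd_algebraMap_add (u : ι → C) (v : ι → A) :
    ∀ l : List ι, commProd (fun p => algebraMap C A (u p) + v p) l = commProd v l
  | [] => rfl
  | [_] => rfl
  | a :: b :: l => by rw [commProd, comm_algebraMap_add, commProd_algebraMap_add u v l, commProd]

lemma commProd_eq_zero_of_mem {v : ι → A} {p : ι} (hp : v p = 0) :
    ∀ l : List ι, p ∈ l → commProd v l = 0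
  | [], h => by simp at h
  | [_], _ => rfl
  | a :: b :: l, h => by
    rcases List.mem_cons.1 h with rfl | h
    · simp [commProd, comm, hp]
    rcases List.mem_cons.1 h with rfl | h
    · simp [commProd, comm, hp]
    · rw [commProd, commProd_eq_zero_of_mem hp l h, mul_zero]

lemma commProd_of_anticommute {v : ι → A} (hv : ∀ p q, v p * v q = -(v q * v p)) :
    ∀ l : List ι, Even l.length → commProd v l = 2 ^ (l.length / 2) • (l.map v).prod
  | [], _ => by simp [commProd]
  | [_], h => by simp at h
  | a :: b :: l, h => by
    have hcomm : comm (v a) (v b) = 2 • (v a * v b) := by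
      rw [comm, hv b a, sub_neg_eq_add, two_nsmul]
    have hlen : (a :: b :: l).length / 2 = l.length / 2 + 1 := by
      simp only [List.length_cons]; omega
    rw [commProd, commProd_of_anticommute hv l (by simp only [List.length_cons] at h; grind),
      hcomm, hlen, smul_mul_smul_comm, pow_succ', List.map_cons, List.map_cons, List.prod_cons,
      List.prod_cons, mul_assoc]

lemma mul_prod_map_eq_zero_of_mem {v : ι → A} (hv : ∀ p q, v p * v q = -(v q * v p))
    (hsq : ∀ p, v p * v p = 0) {p : ι} {l : List ι} (hp : p ∈ l) :
    v p * (l.map v).prod = 0 := by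
  induction l with
  | nil => simp at hp
  | cons a l ih =>
    rw [List.map_cons, List.prod_cons, ← mul_assoc]
    rcases List.mem_cons.1 hp with rfl | h
    · rw [hsq, zero_mul]
    · rw [hv, neg_mul, mul_assoc, ih h, mul_zero, neg_zero]

lemma prod_map_algebraMap_add_mul (u : ι → C) {v : ι → A} {z : A} (hz : ∀ p, v p * z = 0)
    (l : List ι) :
    (l.map fun p => algebraMap C A (u p) + v p).prod * z = (l.map u).prod • z := by
  induction l with
  | nil => simp
  | cons a l ih =>
    simp only [List.map_cons, List.prod_cons, mul_assoc, ih]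
    rw [add_mul, ← Algebra.smul_def, mul_smul_comm, hz, smul_zero, add_zero, smul_smul]

lemma normalForm_algebraMap_add (u : ι → C) {v : ι → A}
    (hv : ∀ p q, v p * v q = -(v q * v p)) (hsq : ∀ p, v p * v p = 0) (q : NormalIndex ι)
    (hq : ∀ p ∉ q.1.1, v p = 0) :
    normalForm (fun p => algebraMap C A (u p) + v p) q =
      (q.2.map u).prod • 2 ^ (#q.1.1 / 2) • (q.1.1.toList.map v).prod := by
  have hmul (p : ι) : v p * (2 ^ (#q.1.1 / 2) • (q.1.1.toList.map v).prod) = 0 := by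
    by_cases hp : p ∈ q.1.1
    · rw [mul_smul_comm, mul_prod_map_eq_zero_of_mem hv hsq (mem_toList.2 hp), smul_zero]
    · rw [hq p hp, zero_mul]
  rw [normalForm, commProd_algebraMap_add, commProd_of_anticommute hv _ (by simpa using q.1.2),
    length_toList, prod_map_algebraMap_add_mul u hmul, Multiset.prod_map_toList]

variable [DecidableEq ι] {w : ι → ℕ → C} {v : ι → A}

/-- The substitution that detects the normal form with the index `q`: the central part of the value
of `x_p` has as many summands as `x_p` occurs in `q.2`, and the anticommuting part is present only
for the variables in `q.1`. -/
def probe (w : ι → ℕ → C) (v : ι → A) (q : NormalIndex ι) (p : ι) : A :=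
  algebraMap C A (∑ j ∈ range (q.2.count p), w p j) + if p ∈ q.1.1 then v p else 0

lemma normalForm_probe_of_not_subset (q r : NormalIndex ι) (hrq : ¬ r.1.1 ⊆ q.1.1) :
    normalForm (probe w v q) r = 0 := by
  obtain ⟨p, hpr, hpq⟩ := not_subset.1 hrq
  have hcomm : commProd (probe w v q) r.1.1.toList = 0 :=
    (commProd_algebraMap_add _ _ _).trans
      (commProd_eq_zero_of_mem (p := p) (by simp only [hpq, if_false]) _ (mem_toList.2 hpr))
  rw [normalForm, hcomm, mul_zero]

lemma normalForm_probe_of_fst_eq (hv : ∀ p q, v p * v q = -(v q * v p))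
    (hsq : ∀ p, v p * v p = 0) {q r : NormalIndex ι} (hrq : r.1 = q.1) :
    normalForm (probe w v q) r = (r.2.map fun p => ∑ j ∈ range (q.2.count p), w p j).prod •
      2 ^ (#q.1.1 / 2) • (q.1.1.toList.map v).prod := by
  set v' : ι → A := fun p => if p ∈ q.1.1 then v p else 0 with hv'
  have hanti (p p' : ι) : v' p * v' p' = -(v' p' * v' p) := by
    simp only [hv']
    split_ifs <;> simp [hv p p']
  have hsq' (p : ι) : v' p * v' p = 0 := by
    simp only [hv']
    split_ifs <;> simp [hsq p]
  have hlist : q.1.1.toList.map v' = q.1.1.toList.map v :=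
    List.map_congr_left fun p hp => if_pos (mem_toList.1 hp)
  have heval := normalForm_algebraMap_add (fun p => ∑ j ∈ range (q.2.count p), w p j) hanti hsq' r
    fun p hp => if_neg (hrq ▸ hp)
  rwa [hrq, hlist] at heval

lemma normalForm_probe_of_not_le (hw : ∀ p j, w p j * w p j = 0)
    (hv : ∀ p q, v p * v q = -(v q * v p)) (hsq : ∀ p, v p * v p = 0) {q r : NormalIndex ι}
    (hrq : r.1 = q.1) (hle : ¬ r.2 ≤ q.2) : normalForm (probe w v q) r = 0 := by
  rw [normalForm_probe_of_fst_eq hv hsq hrq, prod_map_sum_range_count_eq_zero hw hle, zero_smul]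

lemma normalForm_probe_self_ne_zero [IsAddTorsionFree A] (hw : ∀ p j, w p j * w p j = 0)
    (hv : ∀ p q, v p * v q = -(v q * v p)) (hsq : ∀ p, v p * v p = 0)
    (hne : ∀ (s : Finset (Σ _ : ι, ℕ)) (T : Finset ι),
      (∏ k ∈ s, w k.1 k.2) • (T.toList.map v).prod ≠ 0) (q : NormalIndex ι) :
    normalForm (probe w v q) q ≠ 0 := by
  rw [normalForm_probe_of_fst_eq hv hsq rfl, prod_map_sum_range_count hw, mul_smul,
    Nat.cast_smul_eq_nsmul, smul_comm _ (2 ^ (#q.1.1 / 2))]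
  have hfact : ∏ p ∈ q.2.toFinset, (q.2.count p)! ≠ 0 :=
    prod_ne_zero_iff.2 fun p _ => Nat.factorial_ne_zero _
  exact smul_ne_zero hfact (smul_ne_zero (by positivity) (hne _ _))

end Evaluation

section Triangular

variable {F : Type*} [Field F]

/-- Well-founded elimination: in a vanishing combination of the `b q`, evaluating at `φ q` kills the
coefficient at `q` once the coefficients at all smaller indices are known to vanish. -/
lemma eq_zero_of_triangular {V M Q : Type*} [AddCommGroup V] [Module F V] [AddCommGroup M]
    [Module F M] {rel : Q → Q → Prop} [IsWellFounded Q rel] {b : Q → V} {φ : Q → V →ₗ[F] M}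
    (hne : ∀ q, φ q (b q) ≠ 0) (hzero : ∀ q r, r ≠ q → ¬ rel r q → φ q (b r) = 0) {x : V}
    (hx : x ∈ Submodule.span F (Set.range b)) (hφ : ∀ q, φ q x = 0) : x = 0 := by
  obtain ⟨c, rfl⟩ := Finsupp.mem_span_range_iff_exists_finsupp.1 hx
  suffices hc : ∀ q, c q = 0 by simp [Finsupp.sum, hc]
  intro q
  induction q using IsWellFounded.induction rel with
  | _ q ih =>
    have hsum : ∑ r ∈ c.support, c r • φ q (b r) = 0 := by
      simpa [Finsupp.sum] using hφ q
    rw [sum_eq_single q] at hsum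
    · exact (smul_eq_zero.1 hsum).resolve_right (hne q)
    · intro r _ hrq
      by_cases hrel : rel r q
      · rw [ih r hrel, zero_smul]
      · rw [hzero q r hrq hrel, smul_zero]
    · intro hq
      rw [Finsupp.notMem_support_iff.1 hq, zero_smul]

lemma eq_zero_of_lift_probe_eq_zero {A C ι : Type*} [Ring A] [Algebra F A] [IsAddTorsionFree A]
    [CommRing C] [Algebra C A] [DecidableEq ι] {w : ι → ℕ → C} {v : ι → A}
    (hw : ∀ p j, w p j * w p j = 0) (hv : ∀ p q, v p * v q = -(v q * v p))
    (hsq : ∀ p, v p * v p = 0)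
    (hne : ∀ (s : Finset (Σ _ : ι, ℕ)) (T : Finset ι),
      (∏ k ∈ s, w k.1 k.2) • (T.toList.map v).prod ≠ 0)
    {f : FreeAlgebra F ι} (hf : f ∈ Submodule.span F (Set.range (normalForm (FreeAlgebra.ι F))))
    (hprobe : ∀ q, FreeAlgebra.lift F (probe w v q) f = 0) : f = 0 := by
  have heval (q r : NormalIndex ι) :
      FreeAlgebra.lift F (probe w v q) (normalForm (FreeAlgebra.ι F) r) =
        normalForm (probe w v q) r := by
    rw [map_normalForm, FreeAlgebra.ι_comp_lift]
  refine eq_zero_of_triangular (rel := Prod.Lex (· < ·) (· < ·))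
    (φ := fun q => (FreeAlgebra.lift F (probe w v q)).toLinearMap) (fun q => ?_)
    (fun q r hrq hrel => ?_) hf hprobe
  · exact (heval q q).trans_ne (normalForm_probe_self_ne_zero hw hv hsq hne q)
  · refine (heval q r).trans ?_
    by_cases hsub : r.1.1 ⊆ q.1.1
    · have hfst : r.1 = q.1 :=
        (show r.1 ≤ q.1 from hsub).eq_of_not_lt fun hlt => hrel (Prod.lex_def.2 (Or.inl hlt))
      exact normalForm_probe_of_not_le hw hv hsq hfst fun hle => hrel (Prod.lex_def.2
        (Or.inr ⟨hfst, hle.lt_of_ne fun hsnd => hrq (Prod.ext hfst hsnd)⟩))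
    · exact normalForm_probe_of_not_subset q r hsub

end Triangular

section Monomials

variable {F : Type*} [Field F]

lemma monomial_cons (i : ℕ) (l : List ℕ) : monomial F (i :: l) = gen F i * monomial F l := by
  simp only [monomial, List.map_cons, List.prod_cons]

lemma monomial_append (l l' : List ℕ) : monomial F (l ++ l') = monomial F l * monomial F l' := by
  simp only [monomial, List.map_append, List.prod_append]

lemma monomial_flatMap {K : Type*} (W : K → List ℕ) (ks : List K) :
    monomial F (ks.flatMap W) = (ks.map fun k => monomial F (W k)).prod := by
  induction ks with
  | nil => simp [monomial]
  | cons k ks ih => rw [List.flatMap_cons, monomial_append, ih, List.map_cons, List.prod_cons]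

lemma monomial_mem_inducedGrading (deg : ℕ → ℤ) (l : List ℕ) :
    monomial F l ∈ inducedGrading F deg (l.map deg).sum :=
  Submodule.subset_span ⟨l, rfl, rfl⟩

variable (F) in
lemma span_range_monomial : Submodule.span F (Set.range (monomial F)) = ⊤ := by
  have hsup := (DirectSum.Decomposition.isInternal
    (inducedGrading F fun _ => 0)).submodule_iSup_eq_top
  rw [eq_top_iff, ← hsup, iSup_le_iff]
  intro r
  refine Submodule.span_mono ?_
  rintro _ ⟨l, -, rfl⟩
  exact ⟨l, rfl⟩

lemma gen_mul_gen_swap (i j : ℕ) : gen F i * gen F j = -(gen F j * gen F i) :=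
  eq_neg_of_add_eq_zero_left (gen_mul_gen_add_swap i j)

lemma gen_mul_monomial (i : ℕ) (l : List ℕ) :
    gen F i * monomial F l = (-1 : ℤˣ) ^ l.length • (monomial F l * gen F i) := by
  induction l with
  | nil => simp [monomial]
  | cons j l ih =>
    rw [monomial_cons, ← mul_assoc, gen_mul_gen_swap, neg_mul, mul_assoc, ih, mul_smul_comm,
      List.length_cons, pow_succ', mul_smul, Units.neg_smul, one_smul, mul_assoc]

lemma monomial_mul_monomial (l l' : List ℕ) :
    monomial F l * monomial F l' =
      (-1 : ℤˣ) ^ (l.length * l'.length) • (monomial F l' * monomial F l) := by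
  induction l with
  | nil => simp [monomial]
  | cons j l ih =>
    rw [monomial_cons, mul_assoc, ih, mul_smul_comm, ← mul_assoc, gen_mul_monomial, smul_mul_assoc,
      smul_smul, List.length_cons, Nat.succ_mul, pow_add, mul_assoc]

lemma commute_monomial_of_even {l : List ℕ} (hl : Even l.length) (l' : List ℕ) :
    Commute (monomial F l) (monomial F l') := by
  rw [commute_iff_eq, monomial_mul_monomial, (hl.mul_right _).neg_one_pow, one_smul]

lemma monomial_mul_monomial_of_odd {l l' : List ℕ} (hl : Odd l.length) (hl' : Odd l'.length) :
    monomial F l * monomial F l' = -(monomial F l' * monomial F l) := by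
  rw [monomial_mul_monomial, (hl.mul hl').neg_one_pow, Units.neg_smul, one_smul]

lemma monomial_mem_center {l : List ℕ} (hl : Even l.length) :
    monomial F l ∈ Subring.center (Grassmann F) := by
  refine Subring.mem_center_iff.2 fun z => ?_
  have hz : z ∈ Submodule.span F (Set.range (monomial F)) :=
    span_range_monomial F ▸ Submodule.mem_top
  induction hz using Submodule.span_induction with
  | mem _ h =>
    obtain ⟨l', rfl⟩ := h
    exact (commute_monomial_of_even hl l').symm
  | zero => rw [zero_mul, mul_zero]
  | add x y _ _ hx hy => rw [add_mul, mul_add, hx, hy]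
  | smul c x _ hx => rw [smul_mul_assoc, mul_smul_comm, hx]

variable (F) in
lemma centralComm_grassmann : CentralComm (Grassmann F) := by
  refine centralComm_of_span (span_range_monomial F) ?_
  rintro _ ⟨l, rfl⟩ _ ⟨l', rfl⟩ _ ⟨l'', rfl⟩
  by_cases h : Even l.length ∨ Even l'.length
  · have hcomm : Commute (monomial F l) (monomial F l') :=
      h.elim (commute_monomial_of_even · l') fun hl' => (commute_monomial_of_even hl' l).symm
    rw [comm_eq_zero_of_commute hcomm, comm, zero_mul, mul_zero, sub_zero]
  · rw [not_or, Nat.not_even_iff_odd, Nat.not_even_iff_odd] at h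
    have heven : Even (l ++ l').length := by
      rw [List.length_append]
      exact h.1.add_odd h.2
    have hcomm : comm (monomial F l) (monomial F l') = 2 • monomial F (l ++ l') := by
      rw [comm, monomial_mul_monomial_of_odd h.2 h.1, sub_neg_eq_add, ← two_nsmul, monomial_append]
    rw [hcomm]
    exact comm_eq_zero_of_commute ((commute_monomial_of_even heven l'').smul_left 2)

lemma monomial_mul_self {l : List ℕ} (hl : l ≠ []) : monomial F l * monomial F l = 0 := by
  obtain ⟨i, l, rfl⟩ := List.exists_cons_of_ne_nil hl
  have hi : gen F i * monomial F (l ++ i :: l) = 0 :=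
    mul_prod_map_eq_zero_of_mem gen_mul_gen_swap (fun _ => ExteriorAlgebra.ι_sq_zero _)
      (List.mem_append_right l List.mem_cons_self)
  rwa [← monomial_append, List.cons_append, monomial_cons]

/-- The antiderivation of `E` that maps `e_i` to `1` and the other generators to `0`. -/
def contractGen (i : ℕ) : Grassmann F →ₗ[F] Grassmann F :=
  CliffordAlgebra.contractLeft (Q := (0 : QuadraticForm F (ℕ →₀ F))) (Finsupp.lapply i)

lemma contractGen_gen_mul (i j : ℕ) (x : Grassmann F) :
    contractGen i (gen F j * x) = (if j = i then x else 0) - gen F j * contractGen i x := by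
  have h := CliffordAlgebra.contractLeft_ι_mul (Q := (0 : QuadraticForm F (ℕ →₀ F)))
    (Finsupp.lapply i) (Finsupp.single j 1) x
  rw [Finsupp.lapply_apply, Finsupp.single_apply, ite_smul, one_smul, zero_smul] at h
  exact h

lemma contractGen_monomial_of_notMem {i : ℕ} {l : List ℕ} (hi : i ∉ l) :
    contractGen i (monomial F l) = 0 := by
  induction l with
  | nil => exact CliffordAlgebra.contractLeft_one (Q := (0 : QuadraticForm F (ℕ →₀ F))) _
  | cons j l ih =>
    rw [List.mem_cons, not_or] at hi
    rw [monomial_cons, contractGen_gen_mul, ih hi.2, if_neg (Ne.symm hi.1), mul_zero, sub_zero]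

lemma monomial_ne_zero {l : List ℕ} (hl : l.Nodup) : monomial F l ≠ 0 := by
  induction l with
  | nil => exact one_ne_zero
  | cons i l ih =>
    rw [List.nodup_cons] at hl
    have hcontract : contractGen i (monomial F (i :: l)) = monomial F l := by
      rw [monomial_cons, contractGen_gen_mul, contractGen_monomial_of_notMem hl.1, if_pos rfl,
        mul_zero, sub_zero]
    intro h
    exact ih hl.2 (by rw [← hcontract, h, map_zero])

lemma prod_map_monomial_ne_zero {K : Type*} {W : K → Finset ℕ}
    (hW : Pairwise fun k k' => Disjoint (W k) (W k')) {ks : List K} (hks : ks.Nodup) :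
    (ks.map fun k => monomial F (W k).toList).prod ≠ 0 := by
  rw [← monomial_flatMap]
  refine monomial_ne_zero (List.nodup_flatMap.2 ⟨fun k _ => nodup_toList _, ?_⟩)
  refine hks.imp fun hkk' i hi hi' => ?_
  exact disjoint_left.1 (hW hkk') (mem_toList.1 hi) (mem_toList.1 hi')

end Monomials

section DisjointFamilies

lemma exists_pairwise_disjoint {α K : Type*} [Countable K]
    {P : K → Finset α → Prop} (h : ∀ k s, ∃ t, Disjoint t s ∧ P k t) :
    ∃ W : K → Finset α, (∀ k, P k (W k)) ∧ Pairwise fun k k' => Disjoint (W k) (W k') := by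
  classical
  cases isEmpty_or_nonempty K
  · exact ⟨isEmptyElim, isEmptyElim, fun k => isEmptyElim k⟩
  obtain ⟨e, he⟩ := exists_surjective_nat K
  choose t hdisj hP using h
  let used : ℕ → Finset α := Nat.rec ∅ fun n s => s ∪ t (e n) s
  have hmono : Monotone used := monotone_nat_of_le_succ fun _ => subset_union_left
  have hlt {i j : ℕ} (hij : i < j) : Disjoint (t (e i) (used i)) (t (e j) (used j)) :=
    ((hdisj (e j) (used j)).mono_right (subset_union_right.trans (hmono hij))).symm
  have hne : Pairwise fun i j => Disjoint (t (e i) (used i)) (t (e j) (used j)) := fun i j hij =>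
    hij.lt_or_gt.elim hlt fun hji => (hlt hji).symm
  refine ⟨fun k => t k (used (Function.surjInv he k)), fun k => hP _ _, fun k k' hkk' => ?_⟩
  simpa only [Function.surjInv_eq] using hne ((Function.injective_surjInv he).ne hkk')

/-- Every degree is attained by nonempty monomials with an even and with an odd number of
generators, even when finitely many generators are excluded. -/
def HasBothParities (deg : ℕ → ℤ) : Prop :=
  ∀ (r : ℤ) (s : Finset ℕ),
    (∃ t, Disjoint t s ∧ t.Nonempty ∧ Even #t ∧ ∑ i ∈ t, deg i = r) ∧
      ∃ t, Disjoint t s ∧ Odd #t ∧ ∑ i ∈ t, deg i = r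

lemma exists_finset_sum_twoDegree (m n : ℤ) {S : Set ℕ} (hS : S.Infinite) (hSc : Sᶜ.Infinite)
    (a b : ℕ) (s : Finset ℕ) :
    ∃ t, Disjoint t s ∧ #t = a + b ∧ ∑ i ∈ t, twoDegree m n S i = a * m + b * n := by
  obtain ⟨t, ht, rfl⟩ := (hS.sdiff s.finite_toSet).exists_subset_card_eq a
  obtain ⟨t', ht', rfl⟩ := (hSc.sdiff s.finite_toSet).exists_subset_card_eq b
  have htt' : Disjoint t t' := disjoint_left.2 fun i hi hi' => (ht' hi').1 (ht hi).1
  refine ⟨t ∪ t', ?_, card_union_of_disjoint htt', ?_⟩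
  · exact disjoint_union_left.2
      ⟨disjoint_left.2 fun i hi => (ht hi).2, disjoint_left.2 fun i hi => (ht' hi).2⟩
  · have hm : ∀ i ∈ t, twoDegree m n S i = m := fun i hi => if_pos (ht hi).1
    have hn : ∀ i ∈ t', twoDegree m n S i = n := fun i hi => if_neg (ht' hi).1
    rw [sum_union htt', sum_congr rfl hm, sum_congr rfl hn, sum_const, sum_const, nsmul_eq_mul,
      nsmul_eq_mul]

lemma exists_even_add_of_one_of_neg_one {m n : ℤ} {α β α' β' : ℕ}
    (h1 : (1 : ℤ) = α * m + β * n) (h2 : (-1 : ℤ) = α' * m + β' * n) (heven : Even (α + β))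
    (r : ℤ) : ∃ a b : ℕ, 0 < a + b ∧ Even (a + b) ∧ (a * m + b * n : ℤ) = r := by
  -- `r = x - 2k` with `x > 0`: the representation of `-1` is used an even number of times
  obtain ⟨x, k, hx, hr⟩ : ∃ x k : ℕ, 0 < x ∧ (x : ℤ) - 2 * k = r :=
    ⟨(r + 2 * (r.natAbs + 1 : ℕ)).toNat, r.natAbs + 1, by omega, by omega⟩
  have hpos : 0 < α + β := by
    by_contra! h
    obtain ⟨rfl, rfl⟩ : α = 0 ∧ β = 0 := by omega
    simp at h1
  have hsum : x * α + 2 * k * α' + (x * β + 2 * k * β') =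
      x * (α + β) + 2 * (k * (α' + β')) := by ring
  refine ⟨x * α + 2 * k * α', x * β + 2 * k * β', ?_, ?_, ?_⟩
  · rw [hsum]
    positivity
  · rw [hsum]
    exact (heven.mul_left _).add (even_two_mul _)
  · push_cast
    linear_combination hr - x * h1 - 2 * k * h2

lemma hasBothParities_twoDegree {m n : ℤ} {S : Set ℕ} (hS : S.Infinite) (hSc : Sᶜ.Infinite)
    {α β α' β' : ℕ} (h1 : (1 : ℤ) = α * m + β * n) (h2 : (-1 : ℤ) = α' * m + β' * n)
    (heven : Even (α + β)) : HasBothParities (twoDegree m n S) := by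
  intro r s
  constructor
  · obtain ⟨a, b, hpos, hab, rfl⟩ := exists_even_add_of_one_of_neg_one h1 h2 heven r
    obtain ⟨t, hts, hcard, hsum⟩ := exists_finset_sum_twoDegree m n hS hSc a b s
    exact ⟨t, hts, card_pos.1 (hcard ▸ hpos), hcard ▸ hab, hsum⟩
  · obtain ⟨a, b, -, hab, hr⟩ := exists_even_add_of_one_of_neg_one h1 h2 heven (r - m)
    obtain ⟨t, hts, hcard, hsum⟩ := exists_finset_sum_twoDegree m n hS hSc (a + 1) b s
    refine ⟨t, hts, ?_, ?_⟩
    · rw [hcard, add_right_comm]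
      exact hab.add_one
    · rw [hsum]
      push_cast
      linear_combination hr

end DisjointFamilies

section Quotients

variable {R ι : Type*} [CommRing R] {I : TwoSidedIdeal (FreeAlgebra R ι)}

lemma mkₐ_eq_zero_iff {A : Type*} [Ring A] [Algebra R A] {I : TwoSidedIdeal A} {a : A} :
    RingCon.mkₐ R I.ringCon a = 0 ↔ a ∈ I := by
  rw [TwoSidedIdeal.mem_iff]
  exact RingCon.eq I.ringCon

lemma adjoin_range_mkₐ_ι :
    Algebra.adjoin R (Set.range (RingCon.mkₐ R I.ringCon ∘ FreeAlgebra.ι R)) = ⊤ := by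
  rw [Set.range_comp, ← AlgHom.map_adjoin, FreeAlgebra.adjoin_range_ι, Algebra.map_top,
    AlgHom.range_eq_top]
  exact RingCon.mkₐ_surjective _

lemma CentralComm.exists_normalForm_sub_mem [IsAddTorsionFree I.ringCon.Quotient]
    (h : CentralComm I.ringCon.Quotient) (f : FreeAlgebra R ι) :
    ∃ f' ∈ Submodule.span R (Set.range (normalForm (FreeAlgebra.ι R))), f - f' ∈ I := by
  have hcomp : (RingCon.mkₐ R I.ringCon).toLinearMap ∘ normalForm (FreeAlgebra.ι R) =
      normalForm (RingCon.mkₐ R I.ringCon ∘ FreeAlgebra.ι R) :=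
    funext fun q => map_normalForm (RingCon.mkₐ R I.ringCon) _ q
  have hmap : Submodule.map (RingCon.mkₐ R I.ringCon).toLinearMap
      (Submodule.span R (Set.range (normalForm (FreeAlgebra.ι R)))) = ⊤ := by
    rw [Submodule.map_span, ← Set.range_comp, hcomp]
    exact h.span_range_normalForm adjoin_range_mkₐ_ι
  obtain ⟨f', hf', heq⟩ := Submodule.mem_map.1
    (hmap ▸ Submodule.mem_top : RingCon.mkₐ R I.ringCon f ∈ Submodule.map _ _)
  refine ⟨f', hf', mkₐ_eq_zero_iff.1 ((map_sub _ _ _).trans (sub_eq_zero.2 heq.symm))⟩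

end Quotients

section TIdeals

variable {F : Type*} [Field F]

instance freeComponent.gradedMonoid : SetLike.GradedMonoid (freeComponent F) where
  one_mem := Submodule.subset_span ⟨[], rfl, rfl⟩
  mul_mem i j x y hx hy := by
    have hle : freeComponent F i * freeComponent F j ≤ freeComponent F (i + j) := by
      rw [freeComponent, freeComponent, Submodule.span_mul_span]
      apply Submodule.span_mono
      rintro _ ⟨_, ⟨l, rfl, rfl⟩, _, ⟨l', rfl, rfl⟩, rfl⟩
      exact ⟨l ++ l', by simp, by simp⟩
    exact hle (Submodule.mul_mem_mul hx hy)

lemma var_mem (i : ℤ) (k : ℕ) : var F i k ∈ freeComponent F i :=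
  Submodule.subset_span ⟨[(i, k)], by simp, by simp⟩

section

variable {A : Type*} [Ring A] [Algebra F A] (𝒜 : ℤ → Submodule F A)

lemma lift_mem_of_mem_freeComponent [SetLike.GradedMonoid 𝒜] {g : ℤ × ℕ → A}
    (hg : ∀ p, g p ∈ 𝒜 p.1) {i : ℤ} {f : FreeGraded F} (hf : f ∈ freeComponent F i) :
    FreeAlgebra.lift F g f ∈ 𝒜 i := by
  refine (Submodule.span_le (p := (𝒜 i).comap (FreeAlgebra.lift F g).toLinearMap)).2 ?_ hf
  rintro _ ⟨l, rfl, rfl⟩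
  have hword : FreeAlgebra.lift F g (l.map fun p => var F p.1 p.2).prod = (l.map g).prod := by
    rw [map_list_prod, List.map_map]
    exact congrArg List.prod (List.map_congr_left fun p _ => FreeAlgebra.lift_ι_apply g p)
  rw [SetLike.mem_coe, Submodule.mem_comap, AlgHom.toLinearMap_apply, hword]
  exact SetLike.list_prod_map_mem_graded l _ _ fun p _ => hg p

variable [GradedAlgebra 𝒜]

variable {𝒜} in
lemma mem_gradedIdentities {f : FreeGraded F} : f ∈ gradedIdentities 𝒜 ↔
    ∀ g : ℤ × ℕ → A, (∀ p, g p ∈ 𝒜 p.1) → FreeAlgebra.lift F g f = 0 := by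
  rw [gradedIdentities, TwoSidedIdeal.mem_mk']
  rfl

lemma isTIdeal_gradedIdentities : IsTIdeal (gradedIdentities 𝒜) := by
  intro φ hφ f hf
  rw [mem_gradedIdentities] at hf ⊢
  intro g hg
  have hcomp : (FreeAlgebra.lift F g).comp φ =
      FreeAlgebra.lift F fun p => FreeAlgebra.lift F g (φ (var F p.1 p.2)) := by
    ext p
    simp [var]
  calc FreeAlgebra.lift F g (φ f) = _ := DFunLike.congr_fun hcomp f
    _ = 0 := hf _ fun p => lift_mem_of_mem_freeComponent 𝒜 hg (hφ _ _ (var_mem _ _))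

lemma CentralComm.tIdealSpan_tripleCommutators_le (h : CentralComm A) :
    tIdealSpan (tripleCommutators F) ≤ gradedIdentities 𝒜 := by
  refine sInf_le ⟨isTIdeal_gradedIdentities 𝒜, ?_⟩
  rintro _ ⟨i, j, k, rfl⟩
  refine mem_gradedIdentities.2 fun g _ => ?_
  rw [map_comm, map_comm]
  exact h _ _ _

end

variable {I : TwoSidedIdeal (FreeGraded F)}

lemma isTIdeal_tIdealSpan (P : Set (FreeGraded F)) : IsTIdeal (tIdealSpan P) := by
  intro φ hφ f hf
  rw [tIdealSpan, TwoSidedIdeal.mem_sInf] at hf ⊢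
  exact fun I hI => hI.1 φ hφ f (hf I hI)

lemma subset_tIdealSpan (P : Set (FreeGraded F)) {f : FreeGraded F} (hf : f ∈ P) :
    f ∈ tIdealSpan P := by
  rw [tIdealSpan, TwoSidedIdeal.mem_sInf]
  exact fun I hI => hI.2 f hf

lemma IsTIdeal.comm_comm_mem (hI : IsTIdeal I) (hP : ∀ f ∈ tripleCommutators F, f ∈ I)
    {i j k : ℤ} {a b c : FreeGraded F} (ha : a ∈ freeComponent F i) (hb : b ∈ freeComponent F j)
    (hc : c ∈ freeComponent F k) : comm (comm a b) c ∈ I := by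
  let g : ℤ × ℕ → FreeGraded F := Function.update (Function.update (Function.update
    (fun p => var F p.1 p.2) (i, 1) a) (j, 2) b) (k, 3) c
  have hg : ∀ p, g p ∈ freeComponent F p.1 := by
    intro p
    simp only [g, Function.update_apply]
    split_ifs with hk hj hi
    · rwa [hk]
    · rwa [hj]
    · rwa [hi]
    · exact var_mem _ _
  have hmem := hI (FreeAlgebra.lift F g)
    (fun _ _ hf => lift_mem_of_mem_freeComponent (freeComponent F) hg hf) _ (hP _ ⟨i, j, k, rfl⟩)
  simpa [map_comm, var, g, Function.update_apply] using hmem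

lemma IsTIdeal.centralComm_quotient (hI : IsTIdeal I) (hP : ∀ f ∈ tripleCommutators F, f ∈ I) :
    CentralComm I.ringCon.Quotient := by
  have hmk (l : List (ℤ × ℕ)) : (l.map (RingCon.mkₐ F I.ringCon ∘ FreeAlgebra.ι F)).prod =
      RingCon.mkₐ F I.ringCon (l.map fun p => var F p.1 p.2).prod := by
    rw [map_list_prod, List.map_map]
    rfl
  refine centralComm_of_span (F := F) (span_range_prod_eq_top adjoin_range_mkₐ_ι) ?_
  rintro _ ⟨l, rfl⟩ _ ⟨l', rfl⟩ _ ⟨l'', rfl⟩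
  simp only [hmk, ← map_comm]
  exact mkₐ_eq_zero_iff.2 (hI.comm_comm_mem hP (Submodule.subset_span ⟨l, rfl, rfl⟩)
    (Submodule.subset_span ⟨l', rfl, rfl⟩) (Submodule.subset_span ⟨l'', rfl, rfl⟩))

end TIdeals

section Independence

variable {F : Type*} [Field F] {deg : ℕ → ℤ}

lemma HasBothParities.exists_disjoint_families (h : HasBothParities deg) :
    ∃ W : (Σ _ : ℤ × ℕ, ℕ) ⊕ (ℤ × ℕ) → Finset ℕ,
      (∀ k, (W (.inl k)).Nonempty ∧ Even #(W (.inl k)) ∧ ∑ i ∈ W (.inl k), deg i = k.1.1) ∧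
      (∀ p, Odd #(W (.inr p)) ∧ ∑ i ∈ W (.inr p), deg i = p.1) ∧
      Pairwise fun k k' => Disjoint (W k) (W k') := by
  obtain ⟨W, hW, hdisj⟩ := exists_pairwise_disjoint
    (P := Sum.elim (fun (k : Σ _ : ℤ × ℕ, ℕ) t => t.Nonempty ∧ Even #t ∧ ∑ i ∈ t, deg i = k.1.1)
      fun (p : ℤ × ℕ) t => Odd #t ∧ ∑ i ∈ t, deg i = p.1)
    (by
      rintro (k | p) s
      · exact (h k.1.1 s).1
      · exact (h p.1 s).2)
  exact ⟨W, fun k => hW (.inl k), fun p => hW (.inr p), hdisj⟩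

lemma monomial_toList_mem_inducedGrading {t : Finset ℕ} {r : ℤ} (h : ∑ i ∈ t, deg i = r) :
    monomial F t.toList ∈ inducedGrading F deg r := by
  rw [← h, ← sum_map_toList]
  exact monomial_mem_inducedGrading deg _

lemma prod_map_monomial_mul_ne_zero {K K' : Type*} {W : K ⊕ K' → Finset ℕ}
    (hW : Pairwise fun k k' => Disjoint (W k) (W k')) (s : Finset K) (T : Finset K') :
    (s.toList.map fun k => monomial F (W (.inl k)).toList).prod *
      (T.toList.map fun k => monomial F (W (.inr k)).toList).prod ≠ 0 := by
  have hnodup : (s.toList.map Sum.inl ++ T.toList.map Sum.inr).Nodup :=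
    ((nodup_toList s).map Sum.inl_injective).append ((nodup_toList T).map Sum.inr_injective)
      (by simp [List.Disjoint])
  have hprod := prod_map_monomial_ne_zero (F := F) hW hnodup
  rwa [List.map_append, List.prod_append, List.map_map, List.map_map] at hprod

theorem HasBothParities.eq_zero_of_mem_gradedIdentities [CharZero F] (h : HasBothParities deg)
    {f : FreeGraded F} (hf : f ∈ Submodule.span F (Set.range (normalForm (FreeAlgebra.ι F))))
    (hid : f ∈ gradedIdentities (inducedGrading F deg)) : f = 0 := by
  obtain ⟨W, heven, hodd, hdisj⟩ := h.exists_disjoint_families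
  let w (p : ℤ × ℕ) (j : ℕ) : Subring.center (Grassmann F) :=
    ⟨monomial F (W (.inl ⟨p, j⟩)).toList,
      monomial_mem_center ((length_toList _).symm ▸ (heven _).2.1)⟩
  let v (p : ℤ × ℕ) : Grassmann F := monomial F (W (.inr p)).toList
  have hv_odd (p : ℤ × ℕ) : Odd (W (.inr p)).toList.length := (length_toList _).symm ▸ (hodd p).1
  have : IsAddTorsionFree (Grassmann F) := .of_isTorsionFree F _
  refine eq_zero_of_lift_probe_eq_zero (w := w) (v := v)
    (fun p j => Subtype.ext (monomial_mul_self (heven _).1.toList_ne_nil))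
    (fun p q => monomial_mul_monomial_of_odd (hv_odd p) (hv_odd q))
    (fun p => monomial_mul_self (List.ne_nil_of_length_pos (hv_odd p).pos))
    (fun s T => ?_) hf fun q => mem_gradedIdentities.1 hid _ fun p => add_mem ?_ ?_
  · have hprod := prod_map_monomial_mul_ne_zero (F := F) hdisj s T
    rw [Subring.smul_def, smul_eq_mul, ← prod_map_toList, SubmonoidClass.coe_list_prod,
      List.map_map]
    exact hprod
  · change ((∑ j ∈ range (q.2.count p), w p j : Subring.center (Grassmann F)) : Grassmann F) ∈ _
    rw [AddSubmonoidClass.coe_finsetSum]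
    exact sum_mem fun j _ => monomial_toList_mem_inducedGrading (heven ⟨p, j⟩).2.2
  · split_ifs
    · exact monomial_toList_mem_inducedGrading (hodd p).2
    · exact zero_mem _

end Independence

end GradedPI

end

open GradedPI in
theorem proposition3p4_general {F : Type*} [Field F] [CharZero F] {deg : ℕ → ℤ}
    (hdeg : HasBothParities deg) :
    GeneratesVariety (inducedGrading F deg) (tripleCommutators F) := by
  have hle : tIdealSpan (tripleCommutators F) ≤ gradedIdentities (inducedGrading F deg) :=
    (centralComm_grassmann F).tIdealSpan_tripleCommutators_le _
  refine le_antisymm hle fun f hf => ?_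
  have hcentral : CentralComm (tIdealSpan (tripleCommutators F)).ringCon.Quotient :=
    (isTIdeal_tIdealSpan _).centralComm_quotient fun _ => subset_tIdealSpan _
  have : IsAddTorsionFree (tIdealSpan (tripleCommutators F)).ringCon.Quotient :=
    .of_isTorsionFree F _
  obtain ⟨f', hf', hsub⟩ := hcentral.exists_normalForm_sub_mem f
  have hid : f' ∈ gradedIdentities (inducedGrading F deg) :=
    sub_sub_cancel f f' ▸ sub_mem hf (hle hsub)
  have hzero : f' = 0 := hdeg.eq_zero_of_mem_gradedIdentities hf' hid
  rwa [hzero, sub_zero] at hsub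

/-- The coefficients `α, β, α', β'` are arbitrary natural numbers with the two equations; the choice
with minimal sums `α + β` and `α' + β'` is one special case. -/
theorem proposition3p4 {F : Type*} [Field F] [CharZero F] (m n : ℤ) (hmn : m < n)
    (S : Set ℕ) (hS : S.Infinite) (hSc : Sᶜ.Infinite)
    (hsupp : GradedPI.gradingSupport (GradedPI.twoInduced F m n S) = Set.univ)
    (α β α' β' : ℕ)
    (h1 : (1 : ℤ) = α * m + β * n) (h2 : (-1 : ℤ) = α' * m + β' * n)
    (heven : Even (α + β)) (heven' : Even (α' + β')) :
    GradedPI.GeneratesVariety (GradedPI.twoInduced F m n S) (GradedPI.tripleCommutators F) :=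
  proposition3p4_general (GradedPI.hasBothParities_twoDegree hS hSc h1 h2 heven)
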